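/- Let $n\ge 2$ and let $SD_{8n}=\langle x,y : x^{4n}=y^2=1,\ yxy=x^{2n-1}\rangle$ be the semidihedral group. For a finite group $G$, the CCC-graph (commuting conjugacy class graph) $\Gamma_G$ is the simple graph whose vertices are the conjugacy classes of the non-central elements of $G$, two distinct classes being adjacent if some element of one commutes with some element of the other. For a finite simple graph $\mathcal G$ let $CN(\mathcal G)$ be the matrix with zero diagonal whose $(i,j)$ entry, $i\ne j$, is the number of vertices adjacent to both $v_i$ and $v_j$; let $CNRS(\mathcal G)$ be the diagonal matrix of the row sums of $CN(\mathcal G)$; let $CNL=CNRS-CN$ and $CNSL=CNRS+CN$. The CNL-spectrum and CNSL-spectrum of $\mathcal G$ are the multisets of eigenvalues of $CNL(\mathcal G)$ and $CNSL(\mathcal G)$, where $(\alpha)^a$ means that $\alpha$ is listed $a$ times (if the same value is listed more than once, its multiplicities add up). With $\Delta(\mathcal G)=\operatorname{tr}(CNRS(\mathcal G))/|V(\mathcal G)|$, the CNL-energy $LE_{CN}(\mathcal G)$ and the CNSL-energy $LE^+_{CN}(\mathcal G)$ are the sums of $|\alpha-\Delta(\mathcal G)|$ over the eigenvalues $\alpha$,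 counted with multiplicity, of $CNL(\mathcal G)$ and $CNSL(\mathcal G)$, respectively. Write $\Gamma=\Gamma_{SD_{8n}}$. (a) If $n$ is even, then (i) the CNL-spectrum of $\Gamma$ is $\{(0)^3,\ ((2n-1)(2n-3))^{2n-2}\}$ and $$LE_{CN}(\Gamma)=\frac{12(n-1)(4(n-2)n+3)}{2n+1};$$ (ii) the CNSL-spectrum of $\Gamma$ is $\{(0)^2,\ (2(2n-2)(2n-3))^1,\ ((2n-3)^2)^{2n-2}\}$ and $$LE^+_{CN}(\Gamma)=\begin{cases}\frac{28}{5}, & n=2,\\[2pt] \frac{8(n-1)(2n-3)(2n-1)}{2n+1}, & n\ge 4.\end{cases}$$ (b) If $n$ is odd, then (i) the CNL-spectrum of $\Gamma$ is $\{(0)^2,\ (8)^3,\ ((2n-2)(2n-4))^{2n-3}\}$ and $$LE_{CN}(\Gamma)=\begin{cases}24, & n=3,\\[2pt] \frac{4(2n-3)(5(n-3)n+4)}{n+1}, & n\ge 5;\end{cases}$$ (ii) the CNSL-spectrum of $\Gamma$ is $\{(2(2n-3)(2n-4))^1,\ ((2n-4)^2)^{2n-3},\ (12)^1,\ (4)^3\}$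 and $$LE^+_{CN}(\Gamma)=\begin{cases}24, & n=3,\\[2pt] \frac{16(n-3)(n-1)(2n-1)}{n+1}, & n\ge 5.\end{cases}$$ -/

import Mathlib

section CommonNeighborhood

/-- The common neighborhood matrix `CN(Γ)`: the `(i, j)` entry for `i ≠ j` is the number of
vertices adjacent to both `i` and `j`, and the diagonal is zero. -/
noncomputable def cnMatrix {V : Type*} [DecidableEq V] (Γ : SimpleGraph V) : Matrix V V ℝ :=
  Matrix.of fun i j => if i = j then 0 else ((Γ.commonNeighbors i j).ncard : ℝ)

/-- The diagonal matrix of row sums of `CN(Γ)`. -/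
noncomputable def cnrsMatrix {V : Type*} [Fintype V] [DecidableEq V] (Γ : SimpleGraph V) :
    Matrix V V ℝ :=
  Matrix.diagonal fun i => ∑ k, cnMatrix Γ i k

/-- The common neighborhood Laplacian matrix. -/
noncomputable def cnlMatrix {V : Type*} [Fintype V] [DecidableEq V] (Γ : SimpleGraph V) :
    Matrix V V ℝ :=
  cnrsMatrix Γ - cnMatrix Γ

/-- The common neighborhood signless Laplacian matrix. -/
noncomputable def cnslMatrix {V : Type*} [Fintype V] [DecidableEq V] (Γ : SimpleGraph V) :
    Matrix V V ℝ :=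
  cnrsMatrix Γ + cnMatrix Γ

/-- The CNL-spectrum: the multiset of eigenvalues of the CNL-matrix, with multiplicities. -/
noncomputable def cnlSpec {V : Type*} [Fintype V] [DecidableEq V] (Γ : SimpleGraph V) :
    Multiset ℝ :=
  (cnlMatrix Γ).charpoly.roots

/-- The CNSL-spectrum: the multiset of eigenvalues of the CNSL-matrix, with multiplicities. -/
noncomputable def cnslSpec {V : Type*} [Fintype V] [DecidableEq V] (Γ : SimpleGraph V) :
    Multiset ℝ :=
  (cnslMatrix Γ).charpoly.roots

/-- `Δ(Γ) = tr(CNRS(Γ)) / |V(Γ)|`. -/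
noncomputable def cnDelta {V : Type*} [Fintype V] [DecidableEq V] (Γ : SimpleGraph V) : ℝ :=
  (cnrsMatrix Γ).trace / (Fintype.card V : ℝ)

/-- The CNL-energy `LE_CN(Γ)`. -/
noncomputable def cnlEnergy {V : Type*} [Fintype V] [DecidableEq V] (Γ : SimpleGraph V) : ℝ :=
  ((cnlSpec Γ).map fun a => |a - cnDelta Γ|).sum

/-- The CNSL-energy `LE⁺_CN(Γ)`. -/
noncomputable def cnslEnergy {V : Type*} [Fintype V] [DecidableEq V] (Γ : SimpleGraph V) : ℝ :=
  ((cnslSpec Γ).map fun b => |b - cnDelta Γ|).sum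

end CommonNeighborhood

section CCCGraph

/-- The conjugacy classes of the non-central elements of `G`. -/
def CCCVertex (G : Type*) [Group G] : Type _ :=
  {c : ConjClasses G // ∃ x : G, x ∉ Subgroup.center G ∧ ConjClasses.mk x = c}

noncomputable instance CCCVertex.instDecidableEq (G : Type*) [Group G] :
    DecidableEq (CCCVertex G) :=
  Classical.decEq _

noncomputable instance CCCVertex.instFintype (G : Type*) [Group G] [Finite G] :
    Fintype (CCCVertex G) :=
  haveI : Finite (ConjClasses G) := Finite.of_surjective _ ConjClasses.mk_surjective
  haveI : Finite (CCCVertex G) := Subtype.finite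
  Fintype.ofFinite _

/-- The commuting conjugacy class graph: two distinct classes of non-central elements are
adjacent when some element of one commutes with some element of the other. -/
def cccGraph (G : Type*) [Group G] : SimpleGraph (CCCVertex G) where
  Adj c d := c ≠ d ∧
    ∃ x y : G, ConjClasses.mk x = c.1 ∧ ConjClasses.mk y = d.1 ∧ x * y = y * x
  symm := ⟨fun _ _ h => ⟨h.1.symm, by
    obtain ⟨x, y, hx, hy, hxy⟩ := h.2
    exact ⟨y, x, hy, hx, hxy.symm⟩⟩⟩
  loopless := ⟨fun _ h => h.1 rfl⟩

end CCCGraph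

section Semidihedral

/-- The relators of `⟨x, y : x^(4n) = y^2 = 1, yxy = x^(2n-1)⟩`, where `x`, `y` are the free
generators with index `0`, `1`. -/
def semidihedralRels (n : ℕ) : Set (FreeGroup (Fin 2)) :=
  {FreeGroup.of 0 ^ (4 * n),
   FreeGroup.of 1 ^ 2,
   FreeGroup.of 1 * FreeGroup.of 0 * FreeGroup.of 1 * (FreeGroup.of 0 ^ (2 * n - 1))⁻¹}

/-- The semidihedral group `SD_{8n} = ⟨x, y : x^(4n) = y^2 = 1, yxy = x^(2n-1)⟩` (for `n ≥ 2`). -/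
abbrev SD (n : ℕ) : Type :=
  PresentedGroup (semidihedralRels n)

/-- The presented group is finite: each element is a power of `x` times a power of `y`. -/
instance SD.instFinite (n : ℕ) : Finite (SD n) := by
  set x : SD n := PresentedGroup.of 0 with hx
  set y : SD n := PresentedGroup.of 1 with hy
  have h1 : x ^ (4 * n) = 1 := by
    have := PresentedGroup.one_of_mem (rels := semidihedralRels n)
      (x := FreeGroup.of 0 ^ (4 * n)) (by simp [semidihedralRels])
    exact this
  have h2 : y ^ 2 = 1 := by
    have := PresentedGroup.one_of_mem (rels := semidihedralRels n)
      (x := FreeGroup.of 1 ^ 2) (by simp [semidihedralRels])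
    exact this
  have h3 : y * x * y = x ^ (2 * n - 1) := by
    have := PresentedGroup.one_of_mem (rels := semidihedralRels n)
      (x := FreeGroup.of 1 * FreeGroup.of 0 * FreeGroup.of 1 * (FreeGroup.of 0 ^ (2 * n - 1))⁻¹)
      (by simp [semidihedralRels])
    exact mul_inv_eq_one.mp this
  have hyinv : y⁻¹ = y := inv_eq_of_mul_eq_one_left (by rw [← pow_two, h2])
  have hxfin : IsOfFinOrder x := by
    rw [isOfFinOrder_iff_pow_eq_one]
    rcases Nat.eq_zero_or_pos n with rfl | hn
    · refine ⟨1, one_pos, ?_⟩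
      have h : x = y⁻¹ * (y * x * y) * y⁻¹ := by group
      rw [h, h3, hyinv]
      simp [← pow_two, h2]
    · exact ⟨4 * n, by omega, h1⟩
  have hyfin : IsOfFinOrder y := isOfFinOrder_iff_pow_eq_one.mpr ⟨2, two_pos, h2⟩
  have : Finite (Subgroup.zpowers x) := finite_zpowers.mpr hxfin
  have : Finite (Subgroup.zpowers y) := finite_zpowers.mpr hyfin
  have hconj : ∀ i : ℤ, y * x ^ i = (x ^ (2 * n - 1)) ^ i * y := by
    intro i
    have h : (y * x * y⁻¹) ^ i = y * x ^ i * y⁻¹ := conj_zpow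
    rw [hyinv, h3] at h
    rw [h, mul_assoc, ← pow_two, h2, mul_one]
  refine Finite.of_surjective
    (fun p : Subgroup.zpowers x × Subgroup.zpowers y => (p.1 : SD n) * (p.2 : SD n)) ?_
  intro g
  have key : ∃ i j : ℤ, g = x ^ i * y ^ j := by
    have hg : g ∈ Subgroup.closure (Set.range (PresentedGroup.of (rels := semidihedralRels n))) := by
      rw [PresentedGroup.closure_range_of]; trivial
    have hyleft : ∀ i j : ℤ, ∃ i' j' : ℤ, y * (x ^ i * y ^ j) = x ^ i' * y ^ j' := by
      intro i j
      refine ⟨((2 * n - 1 : ℕ) : ℤ) * i, 1 + j, ?_⟩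
      rw [← mul_assoc, hconj, zpow_mul, zpow_natCast, zpow_add, zpow_one, mul_assoc]
    induction hg using Subgroup.closure_induction_left with
    | one => exact ⟨0, 0, by simp⟩
    | mul_left a ha b _ ih =>
      obtain ⟨i, j, rfl⟩ := ih
      obtain ⟨k, rfl⟩ := ha
      fin_cases k
      · exact ⟨1 + i, j, by rw [zpow_add, zpow_one, mul_assoc]; rfl⟩
      · exact hyleft i j
    | inv_mul_cancel a ha b _ ih =>
      obtain ⟨i, j, rfl⟩ := ih
      obtain ⟨k, rfl⟩ := ha
      fin_cases k
      · exact ⟨-1 + i, j, by rw [zpow_add, zpow_neg_one, mul_assoc]; rfl⟩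
      · change ∃ i' j' : ℤ, y⁻¹ * (x ^ i * y ^ j) = x ^ i' * y ^ j'
        rw [hyinv]
        exact hyleft i j
  obtain ⟨i, j, rfl⟩ := key
  exact ⟨(⟨x ^ i, i, rfl⟩, ⟨y ^ j, j, rfl⟩), rfl⟩

end Semidihedral

/-! The graph is a disjoint union of cliques. Put t = 2n-1. Every element is uniquely x^i or x^i y
with i mod 4n. Uniqueness holds because the group acts on ℤ/4n by the affine maps s ↦ i + s and s ↦
i + ts, which are pairwise distinct. Two rotations x^i, x^j are conjugate iff j = i or j = ti, and
x^i is central iff (1-t)i = 0. Two reflections x^i y, x^j y are conjugate iff j - i is a multiple of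
1-t, and they commute iff (1-t)(i-j) = 0.

Let d = gcd(2n-2, 4n), which is 2 for n even and 4 for n odd. The d and 1-t generate the same ideal,
so there are d central elements, (4n-d)/2 noncentral rotation classes and d reflection classes. The
rotation classes form a clique, and none of them is adjacent to a reflection class. Representatives
of adjacent reflection classes differ by a multiple of 4n/d. For n even this is 2n ≡ 0 mod 2, so the
two classes are isolated; for n odd it is n, a unit mod 4, so the four classes form a clique. The
graph is thus K_{2n-1} ⊔ 2K_1 or K_{2n-2} ⊔ K_4 (`SD.exists_colouring_of_even`,
`SD.exists_colouring_of_odd`).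

On K_m one has CN = (m-2)(J-I), so CNL and CNSL are combinations of I and J on each clique and the
spectra follow. The energies then depend only on which eigenvalues exceed Δ, and small n are
exceptional where that order changes or the cliques degenerate. -/

/-! ### Matrices of the form pI + bJ on each fibre of a map -/

open Polynomial in
theorem charpoly_smul_one_add_const {ι R : Type*} [Fintype ι] [DecidableEq ι] [Nonempty ι]
    [CommRing R] [Nontrivial R] (p b : R) :
    (Matrix.of fun i j : ι => if i = j then p + b else b).charpoly =
      (X - C p) ^ (Fintype.card ι - 1) * (X - C (p + Fintype.card ι * b)) := by
  -- The matrix is a scalar shift of a rank-one matrix, whose characteristic polynomial is known.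
  have h : (Matrix.of fun i j : ι => if i = j then p + b else b) =
      Matrix.vecMulVec (fun _ => b) (fun _ => 1) - Matrix.scalar ι (-p) := by
    ext i j
    by_cases hij : i = j
    · subst hij; simp [Matrix.vecMulVec_apply, add_comm]
    · simp [Matrix.vecMulVec_apply, hij]
  obtain ⟨k, hk⟩ : ∃ k, Fintype.card ι = k + 1 :=
    Nat.exists_eq_succ_of_ne_zero Fintype.card_ne_zero
  rw [h, Matrix.charpoly_sub_scalar, Matrix.charpoly_vecMulVec, hk]
  simp [dotProduct, hk, smul_eq_C_mul]
  ring

-- Any enumeration of `κ` makes the matrix block triangular, with blocks pI + bJ. Empty fibres are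
-- excluded because truncated subtraction in `m c - 1` would leave them a spurious linear factor.
open Polynomial in
theorem charpoly_of_fiberwise {V κ : Type*} [Fintype V] [DecidableEq V] [Fintype κ]
    [DecidableEq κ] (M : Matrix V V ℝ) (f : V → κ) (m : κ → ℕ)
    (hm : ∀ c, Nat.card {v // f v = c} = m c) (hm0 : ∀ c, m c ≠ 0) (p b : κ → ℝ)
    (hM : ∀ u v, M u v = if f u = f v then (if u = v then p (f u) + b (f u) else b (f u)) else 0) :
    M.charpoly = ∏ c, (X - C (p c)) ^ (m c - 1) * (X - C (p c + m c * b c)) := by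
  let e := Fintype.equivFin κ
  have ht : M.BlockTriangular (fun v => e (f v)) := by
    intro u v huv
    rw [hM, if_neg]
    intro h
    simp [h] at huv
  rw [Matrix.charpoly, ht.charmatrix.det_fintype, ← Equiv.prod_comp e]
  refine Finset.prod_congr rfl fun c _ => ?_
  rw [← Matrix.charmatrix_toSquareBlock, ← Matrix.charpoly]
  have hc : Nat.card {v // e (f v) = e c} = m c := by simpa using hm c
  rw [Nat.card_eq_fintype_card] at hc
  have : Nonempty {v // e (f v) = e c} := by
    rw [← Fintype.card_pos_iff, hc]; exact Nat.pos_of_ne_zero (hm0 c)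
  rw [← hc, ← charpoly_smul_one_add_const (ι := {v // e (f v) = e c}) (p c) (b c)]
  congr 1
  ext u v
  have hu : f u = c := e.injective u.2
  have hv : f v = c := e.injective v.2
  simp [Matrix.toSquareBlock_def, hM, hu, hv, Subtype.ext_iff]

open Polynomial in
theorem roots_charpoly_of_fiberwise {V κ : Type*} [Fintype V] [DecidableEq V] [Fintype κ]
    [DecidableEq κ] (M : Matrix V V ℝ) (f : V → κ) (m : κ → ℕ)
    (hm : ∀ c, Nat.card {v // f v = c} = m c) (hm0 : ∀ c, m c ≠ 0) (p b : κ → ℝ)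
    (hM : ∀ u v, M u v = if f u = f v then (if u = v then p (f u) + b (f u) else b (f u)) else 0) :
    M.charpoly.roots =
      ∑ c, (Multiset.replicate (m c - 1) (p c) + Multiset.replicate 1 (p c + m c * b c)) := by
  have hne : ∀ c, (X - C (p c)) ^ (m c - 1) * (X - C (p c + m c * b c)) ≠ 0 := fun c =>
    mul_ne_zero (pow_ne_zero _ (X_sub_C_ne_zero _)) (X_sub_C_ne_zero _)
  rw [charpoly_of_fiberwise M f m hm hm0 p b hM, roots_prod _ _ (Finset.prod_ne_zero_iff.2 fun c _ => hne c)]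
  refine Finset.sum_congr rfl fun c _ => ?_
  rw [roots_mul (hne c), roots_pow, roots_X_sub_C, roots_X_sub_C, Multiset.nsmul_singleton,
    Multiset.replicate_one]

/-! ### Disjoint unions of cliques, the cliques being the fibres of `f` -/

section DisjointCliques

variable {V κ : Type*} [Fintype V] [DecidableEq V] [DecidableEq κ]

theorem cnMatrix_of_adj_iff {Γ : SimpleGraph V} {f : V → κ}
    (hΓ : ∀ u v, Γ.Adj u v ↔ u ≠ v ∧ f u = f v) {m : κ → ℕ}
    (hm : ∀ c, Nat.card {v // f v = c} = m c) (u v : V) :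
    cnMatrix Γ u v = if f u = f v ∧ u ≠ v then (m (f u) : ℝ) - 2 else 0 := by
  rw [cnMatrix, Matrix.of_apply]
  by_cases huv : u = v
  · simp [huv]
  rw [if_neg huv]
  by_cases hf : f u = f v
  · rw [if_pos ⟨hf, huv⟩]
    have h1 : Γ.commonNeighbors u v = ({w | f w = f u} : Set V) \ {u, v} := by
      ext w
      simp only [SimpleGraph.mem_commonNeighbors, hΓ, Set.mem_sdiff, Set.mem_ofPred_eq,
        Set.mem_insert_iff, Set.mem_singleton_iff]
      grind
    have h2 : ({u, v} : Set V) ⊆ {w | f w = f u} := by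
      rintro w (rfl | rfl)
      · rfl
      · exact hf.symm
    have h3 := Set.ncard_sdiff_add_ncard_of_subset h2
    rw [Set.ncard_pair huv] at h3
    have h4 : ({w | f w = f u} : Set V).ncard = m (f u) := hm (f u)
    rw [h1, ← h4, ← h3]
    push_cast
    ring
  · rw [if_neg (fun h => hf h.1)]
    have : Γ.commonNeighbors u v = ∅ := by
      ext w
      simp only [SimpleGraph.mem_commonNeighbors, hΓ, Set.mem_empty_iff_false, iff_false]
      grind
    simp [this]

theorem sum_cnMatrix_of_adj_iff {Γ : SimpleGraph V} {f : V → κ}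
    (hΓ : ∀ u v, Γ.Adj u v ↔ u ≠ v ∧ f u = f v) {m : κ → ℕ}
    (hm : ∀ c, Nat.card {v // f v = c} = m c) (u : V) :
    ∑ v, cnMatrix Γ u v = ((m (f u) : ℝ) - 1) * ((m (f u) : ℝ) - 2) := by
  have h : (Finset.univ.filter fun v => f u = f v ∧ u ≠ v) =
      (Finset.univ.filter fun v => f v = f u).erase u := by
    ext v
    simp only [Finset.mem_filter, Finset.mem_univ, true_and, Finset.mem_erase]
    grind
  have hc : (Finset.univ.filter fun v => f v = f u).card = m (f u) := by
    rw [← hm, Nat.card_eq_fintype_card, Fintype.card_subtype]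
  have hpos : 1 ≤ m (f u) := by
    rw [← hc]; exact Finset.card_pos.2 ⟨u, by simp⟩
  simp only [cnMatrix_of_adj_iff hΓ hm]
  rw [← Finset.sum_filter, Finset.sum_const, h, Finset.card_erase_of_mem (by simp), hc,
    nsmul_eq_mul, Nat.cast_sub hpos, Nat.cast_one]

/-- On a clique of size m, CNL = m(m-2)I - (m-2)J. -/
theorem cnlSpec_of_adj_iff [Fintype κ] {Γ : SimpleGraph V} {f : V → κ}
    (hΓ : ∀ u v, Γ.Adj u v ↔ u ≠ v ∧ f u = f v) {m : κ → ℕ}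
    (hm : ∀ c, Nat.card {v // f v = c} = m c) (hm0 : ∀ c, m c ≠ 0) :
    cnlSpec Γ = ∑ c, (Multiset.replicate (m c - 1) ((m c : ℝ) * ((m c : ℝ) - 2)) +
      Multiset.replicate 1 (0 : ℝ)) := by
  rw [cnlSpec, roots_charpoly_of_fiberwise _ f m hm hm0
    (fun c => (m c : ℝ) * ((m c : ℝ) - 2)) (fun c => -((m c : ℝ) - 2))]
  · refine Finset.sum_congr rfl fun c _ => ?_
    congr 2
    ring
  · intro u v
    rw [cnlMatrix, cnrsMatrix, Matrix.sub_apply, Matrix.diagonal_apply,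
      cnMatrix_of_adj_iff hΓ hm, sum_cnMatrix_of_adj_iff hΓ hm]
    by_cases huv : u = v
    · simp only [huv, if_true, ne_eq, not_true_eq_false, and_false, if_false]
      ring
    · simp [huv]; split_ifs <;> simp

/-- On a clique of size m, CNSL = (m-2)²I + (m-2)J. -/
theorem cnslSpec_of_adj_iff [Fintype κ] {Γ : SimpleGraph V} {f : V → κ}
    (hΓ : ∀ u v, Γ.Adj u v ↔ u ≠ v ∧ f u = f v) {m : κ → ℕ}
    (hm : ∀ c, Nat.card {v // f v = c} = m c) (hm0 : ∀ c, m c ≠ 0) :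
    cnslSpec Γ = ∑ c, (Multiset.replicate (m c - 1) (((m c : ℝ) - 2) ^ 2) +
      Multiset.replicate 1 (2 * ((m c : ℝ) - 1) * ((m c : ℝ) - 2))) := by
  rw [cnslSpec, roots_charpoly_of_fiberwise _ f m hm hm0
    (fun c => ((m c : ℝ) - 2) ^ 2) (fun c => (m c : ℝ) - 2)]
  · refine Finset.sum_congr rfl fun c _ => ?_
    congr 2
    ring
  · intro u v
    rw [cnslMatrix, cnrsMatrix, Matrix.add_apply, Matrix.diagonal_apply,
      cnMatrix_of_adj_iff hΓ hm, sum_cnMatrix_of_adj_iff hΓ hm]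
    by_cases huv : u = v
    · simp only [huv, if_true, ne_eq, not_true_eq_false, and_false, if_false]
      ring
    · simp [huv]

theorem cnDelta_of_adj_iff [Fintype κ] {Γ : SimpleGraph V} {f : V → κ}
    (hΓ : ∀ u v, Γ.Adj u v ↔ u ≠ v ∧ f u = f v) {m : κ → ℕ}
    (hm : ∀ c, Nat.card {v // f v = c} = m c) :
    cnDelta Γ = (∑ c, (m c : ℝ) * (((m c : ℝ) - 1) * ((m c : ℝ) - 2))) / (∑ c, (m c : ℝ)) := by
  have hc : ∀ c, (Finset.univ.filter fun v => f v = c).card = m c := fun c => by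
    rw [← hm, Nat.card_eq_fintype_card, Fintype.card_subtype]
  rw [cnDelta, cnrsMatrix, Matrix.trace_diagonal]
  congr 1
  · simp only [sum_cnMatrix_of_adj_iff hΓ hm]
    rw [← Finset.sum_fiberwise _ f]
    refine Finset.sum_congr rfl fun c _ => ?_
    rw [Finset.sum_congr rfl fun v hv => by rw [(Finset.mem_filter.1 hv).2], Finset.sum_const,
      hc, nsmul_eq_mul]
  · rw [← Finset.card_univ, Finset.card_eq_sum_card_fiberwise
      (f := f) (t := Finset.univ) (fun _ _ => Finset.mem_coe.2 (Finset.mem_univ _))]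
    push_cast
    simp only [hc]

end DisjointCliques

/-! ### Normal form, commutation and conjugacy in the semidihedral group -/

namespace SD

/-- The power `x ^ i` of the first generator, for `i` modulo `4n`. -/
def rot (n : ℕ) (i : ZMod (4 * n)) : SD n := PresentedGroup.of 0 ^ i.val

/-- The element `x ^ i * y`, for `i` modulo `4n`. -/
def refl (n : ℕ) (i : ZMod (4 * n)) : SD n := rot n i * PresentedGroup.of 1

/-- The exponent `2n - 1` by which `y` acts on `⟨x⟩`. -/
def twist (n : ℕ) : ZMod (4 * n) := ((2 * n - 1 : ℕ) : ZMod (4 * n))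

variable {n : ℕ}

theorem gen_pow : (PresentedGroup.of 0 : SD n) ^ (4 * n) = 1 :=
  PresentedGroup.one_of_mem (rels := semidihedralRels n)
    (x := FreeGroup.of 0 ^ (4 * n)) (by simp [semidihedralRels])

theorem gen_mul_self : (PresentedGroup.of 1 : SD n) * PresentedGroup.of 1 = 1 := by
  rw [← pow_two]
  exact PresentedGroup.one_of_mem (rels := semidihedralRels n)
    (x := FreeGroup.of 1 ^ 2) (by simp [semidihedralRels])

theorem gen_conj : (PresentedGroup.of 1 : SD n) * PresentedGroup.of 0 * PresentedGroup.of 1 =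
    PresentedGroup.of 0 ^ (2 * n - 1) :=
  mul_inv_eq_one.mp <| PresentedGroup.one_of_mem (rels := semidihedralRels n)
    (x := FreeGroup.of 1 * FreeGroup.of 0 * FreeGroup.of 1 * (FreeGroup.of 0 ^ (2 * n - 1))⁻¹)
    (by simp [semidihedralRels])

theorem rot_natCast (k : ℕ) : rot n (k : ZMod (4 * n)) = PresentedGroup.of 0 ^ k := by
  rw [rot, ZMod.val_natCast, ← pow_eq_pow_mod _ gen_pow]

theorem rot_zero : rot n 0 = 1 := by simpa using rot_natCast (n := n) 0

theorem twist_eq (hn : 2 ≤ n) : twist n = 2 * n - 1 := by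
  rw [twist, Nat.cast_sub (by omega)]; push_cast; rfl

theorem twist_mul_self (hn : 2 ≤ n) : twist n * twist n = 1 := by
  have h : ((4 * n : ℕ) : ZMod (4 * n)) = 0 := ZMod.natCast_self _
  push_cast at h
  rw [twist_eq hn]
  linear_combination ((n : ZMod (4 * n)) - 1) * h

theorem twist_ne_one (hn : 2 ≤ n) : twist n ≠ 1 := by
  intro h
  have h1 : ((2 * n - 1 : ℕ) : ZMod (4 * n)) = ((1 : ℕ) : ZMod (4 * n)) := by simpa [twist] using h
  rw [ZMod.natCast_eq_natCast_iff', Nat.mod_eq_of_lt (by omega), Nat.mod_eq_of_lt (by omega)] at h1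
  omega

section

variable [NeZero n]

theorem rot_add (i j : ZMod (4 * n)) : rot n (i + j) = rot n i * rot n j := by
  obtain ⟨a, rfl⟩ := ZMod.natCast_zmod_surjective i
  obtain ⟨b, rfl⟩ := ZMod.natCast_zmod_surjective j
  rw [← Nat.cast_add, rot_natCast, rot_natCast, rot_natCast, pow_add]

theorem gen_mul_rot (i : ZMod (4 * n)) :
    PresentedGroup.of 1 * rot n i = refl n (twist n * i) := by
  obtain ⟨a, rfl⟩ := ZMod.natCast_zmod_surjective i
  have hinv : (PresentedGroup.of 1 : SD n)⁻¹ = PresentedGroup.of 1 :=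
    inv_eq_of_mul_eq_one_left gen_mul_self
  rw [refl, twist, ← Nat.cast_mul, rot_natCast, rot_natCast, pow_mul, ← gen_conj]
  have h := conj_pow (i := a) (a := (PresentedGroup.of 1 : SD n)) (b := PresentedGroup.of 0)
  rw [hinv] at h
  rw [h, mul_assoc _ (PresentedGroup.of 1 : SD n), gen_mul_self, mul_one]

theorem rot_mul_refl (i j : ZMod (4 * n)) : rot n i * refl n j = refl n (i + j) := by
  rw [refl, refl, rot_add, mul_assoc]

theorem refl_mul_rot (i j : ZMod (4 * n)) :
    refl n i * rot n j = refl n (i + twist n * j) := by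
  rw [refl, mul_assoc, gen_mul_rot, rot_mul_refl]

theorem refl_mul_refl (i j : ZMod (4 * n)) :
    refl n i * refl n j = rot n (i + twist n * j) := by
  rw [show refl n j = rot n j * PresentedGroup.of 1 from rfl, ← mul_assoc, refl_mul_rot, refl,
    mul_assoc, gen_mul_self, mul_one]

/-- These elements form a subgroup containing both generators. -/
theorem eq_rot_or_refl (hn : 2 ≤ n) (g : SD n) : (∃ i, g = rot n i) ∨ ∃ i, g = refl n i := by
  have hneg (i : ZMod (4 * n)) : rot n (-i) = (rot n i)⁻¹ := by
    rw [eq_inv_iff_mul_eq_one, ← rot_add, neg_add_cancel, rot_zero]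
  have hrefl (i : ZMod (4 * n)) : (refl n i)⁻¹ = refl n (-(twist n * i)) := by
    rw [inv_eq_iff_mul_eq_one, refl_mul_refl, mul_neg, ← mul_assoc, twist_mul_self hn, one_mul,
      add_neg_cancel, rot_zero]
  let H : Subgroup (SD n) :=
    { carrier := {g | (∃ i, g = rot n i) ∨ ∃ i, g = refl n i}
      one_mem' := Or.inl ⟨0, rot_zero.symm⟩
      mul_mem' := by
        rintro _ _ (⟨i, rfl⟩ | ⟨i, rfl⟩) (⟨j, rfl⟩ | ⟨j, rfl⟩)
        · exact Or.inl ⟨_, (rot_add i j).symm⟩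
        · exact Or.inr ⟨_, rot_mul_refl i j⟩
        · exact Or.inr ⟨_, refl_mul_rot i j⟩
        · exact Or.inl ⟨_, refl_mul_refl i j⟩
      inv_mem' := by
        rintro _ (⟨i, rfl⟩ | ⟨i, rfl⟩)
        · exact Or.inl ⟨-i, (hneg i).symm⟩
        · exact Or.inr ⟨_, hrefl i⟩ }
  refine PresentedGroup.generated_by _ H (fun j => ?_) g
  fin_cases j
  · exact Or.inl ⟨((1 : ℕ) : ZMod (4 * n)), by rw [rot_natCast, pow_one]; rfl⟩
  · exact Or.inr ⟨0, by rw [refl, rot_zero, one_mul]; rfl⟩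

end

/-- Multiplication by `2n - 1` as a permutation of the residues modulo `4n`. -/
def twistPerm (hn : 2 ≤ n) : Equiv.Perm (ZMod (4 * n)) where
  toFun t := twist n * t
  invFun t := twist n * t
  left_inv t := by simp only [← mul_assoc, twist_mul_self hn, one_mul]
  right_inv t := by simp only [← mul_assoc, twist_mul_self hn, one_mul]

theorem addLeft_pow_apply (k : ℕ) (a t : ZMod (4 * n)) :
    (Equiv.addLeft a ^ k : Equiv.Perm (ZMod (4 * n))) t = k * a + t := by
  induction k with
  | zero => simp
  | succ k ih => rw [pow_succ', Equiv.Perm.mul_apply, ih, Equiv.coe_addLeft]; push_cast; ring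

/-- The action of `SD n` on the residues modulo `4n` by affine maps. -/
def affine (hn : 2 ≤ n) : SD n →* Equiv.Perm (ZMod (4 * n)) :=
  PresentedGroup.toGroup (f := ![Equiv.addLeft 1, twistPerm hn]) (by
    have h4 : ((4 * n : ℕ) : ZMod (4 * n)) = 0 := ZMod.natCast_self _
    rintro r (rfl | rfl | rfl)
    · ext t
      simp only [map_pow, FreeGroup.lift_apply_of, Matrix.cons_val_zero, addLeft_pow_apply, h4]
      simp
    · ext t
      simp [pow_two, twistPerm, ← mul_assoc, twist_mul_self hn]
    · simp only [map_mul, map_inv, mul_inv_eq_one, map_pow, FreeGroup.lift_apply_of]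
      ext t
      simp only [Matrix.cons_val_zero, Matrix.cons_val_one, Equiv.Perm.mul_apply,
        addLeft_pow_apply, Equiv.coe_addLeft]
      simp only [twistPerm, Equiv.coe_fn_mk, mul_add, ← mul_assoc, twist_mul_self hn, mul_one,
        one_mul]
      rfl)

theorem affine_rot [NeZero n] (hn : 2 ≤ n) (i t : ZMod (4 * n)) :
    affine hn (rot n i) t = i + t := by
  rw [rot, map_pow, affine, PresentedGroup.toGroup.of]
  simp only [Matrix.cons_val_zero, addLeft_pow_apply]
  simp

theorem affine_refl [NeZero n] (hn : 2 ≤ n) (i t : ZMod (4 * n)) :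
    affine hn (refl n i) t = i + twist n * t := by
  rw [refl, map_mul, Equiv.Perm.mul_apply, affine_rot, affine, PresentedGroup.toGroup.of]
  rfl

variable [NeZero n]

/-- The affine map attached to an element sends 0 to its exponent, so the presentation does not
collapse. -/
theorem rot_injective (hn : 2 ≤ n) : Function.Injective (rot n) := fun i j h => by
  simpa [affine_rot] using congrArg (fun g => affine hn g 0) h

theorem refl_injective (hn : 2 ≤ n) : Function.Injective (refl n) := fun i j h => by
  simpa [affine_refl] using congrArg (fun g => affine hn g 0) h

theorem rot_ne_refl (hn : 2 ≤ n) (i j : ZMod (4 * n)) : rot n i ≠ refl n j := by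
  intro h
  -- Agreement at 0 gives i = j; agreement at 1 would then force `twist n = 1`.
  have h0 := congrArg (fun g => affine hn g 0) h
  have h1 := congrArg (fun g => affine hn g 1) h
  simp only [affine_rot, affine_refl, mul_zero, add_zero, mul_one] at h0 h1
  rw [h0] at h1
  exact twist_ne_one hn (add_left_cancel h1).symm

theorem commute_rot_rot (i j : ZMod (4 * n)) : Commute (rot n i) (rot n j) := by
  rw [commute_iff_eq, ← rot_add, ← rot_add, add_comm]

theorem commute_rot_refl_iff (hn : 2 ≤ n) (i j : ZMod (4 * n)) :
    Commute (rot n i) (refl n j) ↔ twist n * i = i := by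
  rw [commute_iff_eq, rot_mul_refl, refl_mul_rot, (refl_injective hn).eq_iff, add_comm,
    add_right_inj, eq_comm]

theorem commute_refl_refl_iff (hn : 2 ≤ n) (i j : ZMod (4 * n)) :
    Commute (refl n i) (refl n j) ↔ twist n * (i - j) = i - j := by
  rw [commute_iff_eq, refl_mul_refl, refl_mul_refl, (rot_injective hn).eq_iff]
  constructor <;> intro h <;> linear_combination -h

theorem rot_mem_center_iff (hn : 2 ≤ n) (i : ZMod (4 * n)) :
    rot n i ∈ Subgroup.center (SD n) ↔ twist n * i = i := by
  rw [Subgroup.mem_center_iff]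
  constructor
  · intro h
    exact (commute_rot_refl_iff hn i 0).1 (h (refl n 0)).symm
  · intro h g
    obtain ⟨j, rfl⟩ | ⟨j, rfl⟩ := eq_rot_or_refl hn g
    · exact commute_rot_rot j i
    · exact ((commute_rot_refl_iff hn i j).2 h).symm

theorem refl_notMem_center (hn : 2 ≤ n) (i : ZMod (4 * n)) :
    refl n i ∉ Subgroup.center (SD n) := by
  intro h
  have h1 : Commute (rot n 1) (refl n i) := Subgroup.mem_center_iff.1 h (rot n 1)
  rw [commute_rot_refl_iff hn, mul_one] at h1
  exact twist_ne_one hn h1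

theorem isConj_rot_rot_iff (hn : 2 ≤ n) (i j : ZMod (4 * n)) :
    IsConj (rot n i) (rot n j) ↔ j = i ∨ j = twist n * i := by
  rw [isConj_iff]
  simp only [mul_inv_eq_iff_eq_mul]
  constructor
  · rintro ⟨g, hg⟩
    obtain ⟨k, rfl⟩ | ⟨k, rfl⟩ := eq_rot_or_refl hn g
    · rw [← rot_add, ← rot_add, (rot_injective hn).eq_iff, add_comm, add_left_inj] at hg
      exact Or.inl hg.symm
    · rw [refl_mul_rot, rot_mul_refl, (refl_injective hn).eq_iff, add_comm, add_left_inj] at hg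
      exact Or.inr hg.symm
  · rintro (rfl | rfl)
    · exact ⟨1, by simp⟩
    · exact ⟨refl n 0, by rw [refl_mul_rot, rot_mul_refl, add_comm]⟩

theorem not_isConj_rot_refl (hn : 2 ≤ n) (i j : ZMod (4 * n)) :
    ¬ IsConj (rot n i) (refl n j) := by
  rw [isConj_iff]
  simp only [mul_inv_eq_iff_eq_mul]
  rintro ⟨g, hg⟩
  obtain ⟨k, rfl⟩ | ⟨k, rfl⟩ := eq_rot_or_refl hn g
  · rw [← rot_add, refl_mul_rot] at hg
    exact rot_ne_refl hn _ _ hg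
  · rw [refl_mul_rot, refl_mul_refl] at hg
    exact rot_ne_refl hn _ _ hg.symm

theorem isConj_refl_refl_iff (hn : 2 ≤ n) (i j : ZMod (4 * n)) :
    IsConj (refl n i) (refl n j) ↔ ∃ t, j - i = (1 - twist n) * t := by
  rw [isConj_iff]
  simp only [mul_inv_eq_iff_eq_mul]
  constructor
  · rintro ⟨g, hg⟩
    obtain ⟨k, rfl⟩ | ⟨k, rfl⟩ := eq_rot_or_refl hn g
    · rw [rot_mul_refl, refl_mul_rot, (refl_injective hn).eq_iff] at hg
      exact ⟨k, by linear_combination -hg⟩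
    · rw [refl_mul_refl, refl_mul_refl, (rot_injective hn).eq_iff] at hg
      -- The equation is k + ti = j + tk with t = `twist n`, that is, j - i = (1-t)(k-i).
      exact ⟨k - i, by linear_combination -hg⟩
  · rintro ⟨t, ht⟩
    refine ⟨rot n t, ?_⟩
    rw [rot_mul_refl, refl_mul_rot]
    congr 1
    linear_combination -ht

end SD

/-! ### Conjugacy classes and adjacency in the CCC-graph -/

namespace SD

variable {n : ℕ}

theorem card_nsmul_eq_zero [NeZero n] {d : ℕ} (hd : d ∣ 4 * n) :
    Nat.card {i : ZMod (4 * n) // (d : ZMod (4 * n)) * i = 0} = d := by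
  have h := IsAddCyclic.card_nsmulAddMonoidHom_ker (ZMod (4 * n)) d
  rw [Nat.card_zmod, Nat.gcd_eq_right hd] at h
  refine Eq.trans ?_ h
  exact Nat.card_congr (Equiv.subtypeEquivRight fun i => by simp [AddMonoidHom.mem_ker])

theorem castHom_eq_zero_iff [NeZero n] {d : ℕ} (hd : d ∣ 4 * n) (i : ZMod (4 * n)) :
    ZMod.castHom hd (ZMod d) i = 0 ↔ ∃ t, i = d * t := by
  constructor
  · obtain ⟨a, rfl⟩ := ZMod.natCast_zmod_surjective i
    rw [map_natCast, ZMod.natCast_eq_zero_iff]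
    rintro ⟨b, rfl⟩
    exact ⟨b, by push_cast; rfl⟩
  · rintro ⟨t, rfl⟩
    rw [map_mul, map_natCast, ZMod.natCast_self, zero_mul]

open Classical in
/-- The vertex colouring of the CCC-graph: classes of rotations receive no colour, and the class
of `x ^ i * y` is coloured by the residue of `i` modulo `d`. -/
noncomputable def colour {d : ℕ} (hd : d ∣ 4 * n) (v : CCCVertex (SD n)) : Option (ZMod d) :=
  if h : ∃ i, ConjClasses.mk (refl n i) = v.1 then some (ZMod.castHom hd (ZMod d) h.choose)
  else none

theorem exists_rot_or_refl [NeZero n] (hn : 2 ≤ n) (v : CCCVertex (SD n)) :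
    (∃ i, twist n * i ≠ i ∧ ConjClasses.mk (rot n i) = v.1) ∨
      ∃ i, ConjClasses.mk (refl n i) = v.1 := by
  obtain ⟨c, g, hg, rfl⟩ := v
  obtain ⟨i, rfl⟩ | ⟨i, rfl⟩ := eq_rot_or_refl hn g
  · exact Or.inl ⟨i, fun h => hg ((rot_mem_center_iff hn i).2 h), rfl⟩
  · exact Or.inr ⟨i, rfl⟩

theorem colour_of_rot [NeZero n] (hn : 2 ≤ n) {d : ℕ} (hd : d ∣ 4 * n) {v : CCCVertex (SD n)}
    {i : ZMod (4 * n)} (h : ConjClasses.mk (rot n i) = v.1) : colour hd v = none := by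
  rw [colour, dif_neg]
  rintro ⟨j, hj⟩
  exact not_isConj_rot_refl hn i j (ConjClasses.mk_eq_mk_iff_isConj.1 (h.trans hj.symm))

section

variable [NeZero n] {d : ℕ} (hn : 2 ≤ n) (hd : d ∣ 4 * n)
  (h1 : ∃ a, (1 - twist n) * a = d) (h2 : ∃ b, (d : ZMod (4 * n)) * b = 1 - twist n)

include h1 h2

-- The hypotheses `h1` and `h2` say that `d` and `1 - twist n` generate the same ideal; hence they
-- have the same annihilator.
omit [NeZero n] in
theorem twist_mul_eq_self_iff (i : ZMod (4 * n)) : twist n * i = i ↔ (d : ZMod (4 * n)) * i = 0 := by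
  obtain ⟨a, ha⟩ := h1
  obtain ⟨b, hb⟩ := h2
  constructor <;> intro h
  · linear_combination -i * ha - a * h
  · linear_combination i * hb - b * h

include hn

theorem mk_refl_eq_mk_refl_iff (i j : ZMod (4 * n)) :
    ConjClasses.mk (refl n i) = ConjClasses.mk (refl n j) ↔
      ZMod.castHom hd (ZMod d) i = ZMod.castHom hd (ZMod d) j := by
  rw [ConjClasses.mk_eq_mk_iff_isConj, isConj_refl_refl_iff hn, eq_comm (b := ZMod.castHom hd _ j),
    ← sub_eq_zero (b := ZMod.castHom hd _ i), ← map_sub, castHom_eq_zero_iff]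
  obtain ⟨a, ha⟩ := h1
  obtain ⟨b, hb⟩ := h2
  constructor
  · rintro ⟨t, ht⟩
    exact ⟨b * t, by rw [ht, ← mul_assoc, hb]⟩
  · rintro ⟨t, ht⟩
    exact ⟨a * t, by rw [ht, ← mul_assoc, ha]⟩

theorem colour_of_refl {v : CCCVertex (SD n)} {i : ZMod (4 * n)}
    (h : ConjClasses.mk (refl n i) = v.1) :
    colour hd v = some (ZMod.castHom hd (ZMod d) i) := by
  have hex : ∃ i, ConjClasses.mk (refl n i) = v.1 := ⟨i, h⟩
  rw [colour, dif_pos hex, Option.some_inj, ← mk_refl_eq_mk_refl_iff hn hd h1 h2, h]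
  exact hex.choose_spec

theorem colour_eq_some_iff (v : CCCVertex (SD n)) (i : ZMod (4 * n)) :
    colour hd v = some (ZMod.castHom hd (ZMod d) i) ↔ ConjClasses.mk (refl n i) = v.1 := by
  refine ⟨fun h => ?_, colour_of_refl hn hd h1 h2⟩
  obtain ⟨j, -, hj⟩ | ⟨j, hj⟩ := exists_rot_or_refl hn v
  · rw [colour_of_rot hn hd hj] at h
    cases h
  · rw [colour_of_refl hn hd h1 h2 hj, Option.some_inj] at h
    rw [← hj, mk_refl_eq_mk_refl_iff hn hd h1 h2, h]

theorem colour_eq_none_iff (v : CCCVertex (SD n)) :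
    colour hd v = none ↔ ∃ i, twist n * i ≠ i ∧ ConjClasses.mk (rot n i) = v.1 := by
  refine ⟨fun h => ?_, fun ⟨i, _, hi⟩ => colour_of_rot hn hd hi⟩
  obtain hv | ⟨j, hj⟩ := exists_rot_or_refl hn v
  · exact hv
  · rw [colour_of_refl hn hd h1 h2 hj] at h
    cases h

theorem card_colour_eq_some (j : ZMod d) : Nat.card {v // colour hd v = some j} = 1 := by
  obtain ⟨i, rfl⟩ := ZMod.castHom_surjective hd j
  simp only [colour_eq_some_iff hn hd h1 h2]
  rw [Nat.card_eq_one_iff_unique]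
  refine ⟨⟨fun u v => Subtype.ext (Subtype.ext (u.2.symm.trans v.2))⟩, ?_⟩
  exact ⟨⟨⟨_, refl n i, refl_notMem_center hn i, rfl⟩, rfl⟩⟩

/-- The 4n - d noncentral rotations are partitioned into classes {i, ti}, each with exactly two
elements. -/
theorem card_colour_eq_none : Nat.card {v // colour hd v = none} * 2 + d = 4 * n := by
  classical
  let toVertex (i : {i : ZMod (4 * n) // twist n * i ≠ i}) : {v // colour hd v = none} :=
    ⟨⟨_, rot n i, fun h => i.2 ((rot_mem_center_iff hn i.1).1 h), rfl⟩, colour_of_rot hn hd rfl⟩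
  have hfib (v : {v // colour hd v = none}) :
      (Finset.univ.filter fun i => toVertex i = v).card = 2 := by
    obtain ⟨i, hi, hv⟩ := (colour_eq_none_iff hn hd h1 h2 v.1).1 v.2
    have hi' : twist n * (twist n * i) ≠ twist n * i := by
      rw [← mul_assoc, twist_mul_self hn, one_mul]; exact hi.symm
    rw [Finset.card_eq_two]
    refine ⟨⟨i, hi⟩, ⟨twist n * i, hi'⟩, fun h => hi (Subtype.ext_iff.1 h).symm, ?_⟩
    ext j
    simp only [Finset.mem_filter, Finset.mem_univ, true_and, Finset.mem_insert,
      Finset.mem_singleton, Subtype.ext_iff]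
    have hval : (toVertex j).1 = v.1 ↔ ConjClasses.mk (rot n j.1) = v.1.1 :=
      ⟨fun h => congrArg Subtype.val h, fun h => Subtype.ext h⟩
    refine hval.trans ?_
    rw [← hv, eq_comm, ConjClasses.mk_eq_mk_iff_isConj, isConj_rot_rot_iff hn]
  have hS : Fintype.card {i : ZMod (4 * n) // twist n * i ≠ i} =
      Nat.card {v // colour hd v = none} * 2 := by
    rw [← Finset.card_univ, Finset.card_eq_sum_card_fiberwise (f := toVertex) (t := Finset.univ)
      (fun _ _ => Finset.mem_coe.2 (Finset.mem_univ _)), Finset.sum_const_nat fun v _ => hfib v,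
      Finset.card_univ, Nat.card_eq_fintype_card]
  have hK : Fintype.card {i : ZMod (4 * n) // twist n * i = i} = d := by
    rw [← Nat.card_eq_fintype_card]
    simp only [twist_mul_eq_self_iff h1 h2]
    exact card_nsmul_eq_zero hd
  have hC := Fintype.card_subtype_compl fun i : ZMod (4 * n) => twist n * i = i
  have hle := Fintype.card_subtype_le fun i : ZMod (4 * n) => twist n * i = i
  rw [hK, ZMod.card] at hC hle
  change Fintype.card {i : ZMod (4 * n) // twist n * i ≠ i} = _ at hC
  omega

theorem cccGraph_adj_iff (u v : CCCVertex (SD n)) :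
    (cccGraph (SD n)).Adj u v ↔ u ≠ v ∧ ((colour hd u = none ∧ colour hd v = none) ∨
      ∃ i j, colour hd u = some (ZMod.castHom hd (ZMod d) i) ∧
        colour hd v = some (ZMod.castHom hd (ZMod d) j) ∧ (d : ZMod (4 * n)) * (i - j) = 0) := by
  change _ ∧ _ ↔ _
  refine and_congr_right fun _ => ?_
  -- Every rotation in a vertex is noncentral, so it commutes with no reflection.
  have hnc (w : CCCVertex (SD n)) (i : ZMod (4 * n)) (h : ConjClasses.mk (rot n i) = w.1) :
      twist n * i ≠ i := by
    intro hi
    obtain ⟨g, hg, hgw⟩ := w.2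
    obtain ⟨j, rfl⟩ | ⟨j, rfl⟩ := eq_rot_or_refl hn g
    · rw [← h, ConjClasses.mk_eq_mk_iff_isConj] at hgw
      rcases (isConj_rot_rot_iff hn i j).1 hgw.symm with rfl | rfl
      · exact hg ((rot_mem_center_iff hn _).2 hi)
      · rw [hi] at hg
        exact hg ((rot_mem_center_iff hn _).2 hi)
    · rw [← h, ConjClasses.mk_eq_mk_iff_isConj] at hgw
      exact not_isConj_rot_refl hn _ _ hgw.symm
  constructor
  · rintro ⟨g, k, hg, hk, hgk⟩
    obtain ⟨i, rfl⟩ | ⟨i, rfl⟩ := eq_rot_or_refl hn g <;>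
    obtain ⟨j, rfl⟩ | ⟨j, rfl⟩ := eq_rot_or_refl hn k
    · exact Or.inl ⟨colour_of_rot hn hd hg, colour_of_rot hn hd hk⟩
    · exact absurd ((commute_rot_refl_iff hn i j).1 hgk) (hnc u i hg)
    · exact absurd ((commute_rot_refl_iff hn j i).1 hgk.symm) (hnc v j hk)
    · exact Or.inr ⟨i, j, colour_of_refl hn hd h1 h2 hg, colour_of_refl hn hd h1 h2 hk,
        (twist_mul_eq_self_iff h1 h2 _).1 ((commute_refl_refl_iff hn i j).1 hgk)⟩
  · rintro (⟨hu, hv⟩ | ⟨i, j, hu, hv, hij⟩)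
    · obtain ⟨i, -, hi⟩ := (colour_eq_none_iff hn hd h1 h2 u).1 hu
      obtain ⟨j, -, hj⟩ := (colour_eq_none_iff hn hd h1 h2 v).1 hv
      exact ⟨_, _, hi, hj, commute_rot_rot i j⟩
    · exact ⟨_, _, (colour_eq_some_iff hn hd h1 h2 u i).1 hu,
        (colour_eq_some_iff hn hd h1 h2 v j).1 hv, (commute_refl_refl_iff hn i j).2
          ((twist_mul_eq_self_iff h1 h2 _).2 hij)⟩

end

theorem eq_of_colour_eq_some [NeZero n] {d : ℕ} (hn : 2 ≤ n) (hd : d ∣ 4 * n)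
    (h1 : ∃ a, (1 - twist n) * a = d) (h2 : ∃ b, (d : ZMod (4 * n)) * b = 1 - twist n)
    {u v : CCCVertex (SD n)} {j : ZMod d} (hu : colour hd u = some j) (hv : colour hd v = some j) :
    u = v := by
  have h := (Nat.card_eq_one_iff_unique.1 (card_colour_eq_some hn hd h1 h2 j)).1
  exact congrArg Subtype.val (h.elim ⟨u, hu⟩ ⟨v, hv⟩)

theorem exists_colouring_of_even (hn : 2 ≤ n) (he : Even n) :
    ∃ f : CCCVertex (SD n) → Option (ZMod 2),
      (∀ u v, (cccGraph (SD n)).Adj u v ↔ u ≠ v ∧ f u = f v) ∧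
      ∀ c, Nat.card {v // f v = c} = c.elim (2 * n - 1) fun _ => 1 := by
  have : NeZero n := ⟨by omega⟩
  have hd : 2 ∣ 4 * n := ⟨2 * n, by ring⟩
  have h0 : ((4 * n : ℕ) : ZMod (4 * n)) = 0 := ZMod.natCast_self _
  have hn2 : ∃ m : ℕ, (n : ZMod (4 * n)) = 2 * m := by
    obtain ⟨m, hm⟩ := he
    exact ⟨m, by rw [← two_mul] at hm; exact_mod_cast congrArg (Nat.cast (R := ZMod (4 * n))) hm⟩
  obtain ⟨m, hm⟩ := hn2
  push_cast at h0
  -- 2(1-n)² = 2 + 2n(n-2), and 4n divides 2n(n-2) because n is even.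
  have h1 : ∃ a, (1 - twist n) * a = (2 : ℕ) := ⟨1 - n, by
    rw [twist_eq hn]; push_cast
    linear_combination (m - 1 : ZMod (4 * n)) * h0 + 2 * n * hm⟩
  have h2 : ∃ b, ((2 : ℕ) : ZMod (4 * n)) * b = 1 - twist n := ⟨1 - n, by
    rw [twist_eq hn]; push_cast; ring⟩
  refine ⟨colour hd, fun u v => ?_, ?_⟩
  · rw [cccGraph_adj_iff hn hd h1 h2]
    refine and_congr_right fun huv => ⟨?_, fun h => ?_⟩
    · rintro (⟨hu, hv⟩ | ⟨i, j, hu, hv, hij⟩)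
      · rw [hu, hv]
      · rw [hu, hv, Option.some_inj, ← sub_eq_zero, ← map_sub]
        -- From 2k = 0 mod 4n, k is a multiple of 2n, hence even: commuting reflections have the
        -- same colour.
        generalize i - j = k at hij
        obtain ⟨a, rfl⟩ := ZMod.natCast_zmod_surjective k
        rw [← Nat.cast_mul, ZMod.natCast_eq_zero_iff] at hij
        rw [map_natCast, ZMod.natCast_eq_zero_iff]
        obtain ⟨b, hb⟩ := hij
        rw [mul_assoc] at hb
        exact ⟨n * b, by omega⟩
    · rcases hv : colour hd v with _ | j
      · exact Or.inl ⟨h.trans hv, rfl⟩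
      · exact absurd (eq_of_colour_eq_some hn hd h1 h2 (h.trans hv) hv) huv
  · rintro (_ | j)
    · have := card_colour_eq_none hn hd h1 h2
      simp only [Option.elim_none]
      omega
    · exact card_colour_eq_some hn hd h1 h2 j

theorem exists_colouring_of_odd (hn : 2 ≤ n) (ho : Odd n) :
    ∃ f : CCCVertex (SD n) → Bool,
      (∀ u v, (cccGraph (SD n)).Adj u v ↔ u ≠ v ∧ f u = f v) ∧
      ∀ c, Nat.card {v // f v = c} = cond c 4 (2 * n - 2) := by
  have : NeZero n := ⟨by omega⟩
  have hd : 4 ∣ 4 * n := ⟨n, rfl⟩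
  have h0 : ((4 * n : ℕ) : ZMod (4 * n)) = 0 := ZMod.natCast_self _
  push_cast at h0
  obtain ⟨m, hm⟩ := ho
  have hm' : (n : ZMod (4 * n)) = 2 * m + 1 := by
    exact_mod_cast congrArg (Nat.cast (R := ZMod (4 * n))) hm
  have h1 : ∃ a, (1 - twist n) * a = (4 : ℕ) := ⟨2, by
    rw [twist_eq hn]; push_cast
    linear_combination -h0⟩
  have h2 : ∃ b, ((4 : ℕ) : ZMod (4 * n)) * b = 1 - twist n := ⟨-m, by
    rw [twist_eq hn]; push_cast
    linear_combination 2 * hm'⟩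
  -- An odd n is its own inverse mod 4.
  have hsq : (n : ZMod 4) * n = 1 := by
    have h : ∀ x : ZMod 4, (2 * x + 1) * (2 * x + 1) = 1 := by decide
    have h' : (n : ZMod 4) = 2 * m + 1 := by
      exact_mod_cast congrArg (Nat.cast (R := ZMod 4)) hm
    rw [h', h]
  refine ⟨fun v => (colour hd v).isSome, fun u v => ?_, ?_⟩
  · rw [cccGraph_adj_iff hn hd h1 h2]
    refine and_congr_right fun huv => ⟨?_, fun h => ?_⟩
    · rintro (⟨hu, hv⟩ | ⟨i, j, hu, hv, hij⟩)
      · simp only [hu, hv]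
      · simp only [hu, hv, Option.isSome_some]
    · rcases hu : colour hd u with _ | a <;> rcases hv : colour hd v with _ | b
      · exact Or.inl ⟨rfl, rfl⟩
      · simp [hu, hv] at h
      · simp [hu, hv] at h
      -- The first exponent lifts `a`, since n² ≡ 1 mod 4, and differs from the lift of `b` by a
      -- multiple of n, which 4 annihilates mod 4n.
      · refine Or.inr ⟨b.val + n * (n * (a - b).val : ℕ), b.val, ?_, ?_, ?_⟩
        · simp only [map_add, map_mul, map_natCast, Nat.cast_mul, ZMod.natCast_zmod_val]
          rw [← mul_assoc, hsq, one_mul, add_sub_cancel]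
        · simp
        · push_cast
          linear_combination (n * (a - b).val : ZMod (4 * n)) * h0
  · have hnone := card_colour_eq_none hn hd h1 h2
    have hN : Nat.card {v // (colour hd v).isSome = false} = 2 * n - 2 := by
      simp only [Option.isSome_eq_false_iff, Option.isNone_iff_eq_none]
      omega
    have hS : Nat.card {v // (colour hd v).isSome = true} = 4 := by
      refine (Nat.card_eq_of_bijective
        (fun v : {v // (colour hd v).isSome = true} => (colour hd v.1).get v.2)
        ⟨fun u v huv => ?_, fun j => ?_⟩).trans (Nat.card_zmod 4)
      · refine Subtype.ext (eq_of_colour_eq_some hn hd h1 h2 (Option.some_get u.2).symm ?_)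
        exact (Option.some_get v.2).symm.trans (congrArg some huv.symm)
      · have := (Nat.card_eq_one_iff_unique.1 (card_colour_eq_some hn hd h1 h2 j)).2
        obtain ⟨v, hv⟩ := this
        exact ⟨⟨v, by simp [hv]⟩, by simp [hv]⟩
    rintro (_ | _)
    · exact hN
    · exact hS

end SD

/-! ### Spectra and energies in the two parities -/

section SemidihedralSpectra

variable {n : ℕ}

theorem cnlSpec_cccGraph_SD_of_even (hn : 2 ≤ n) (he : Even n) :
    cnlSpec (cccGraph (SD n)) = Multiset.replicate 3 (0 : ℝ) +
      Multiset.replicate (2 * n - 2) ((2 * (n : ℝ) - 1) * (2 * (n : ℝ) - 3)) := by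
  obtain ⟨f, hf, hm⟩ := SD.exists_colouring_of_even hn he
  rw [cnlSpec_of_adj_iff hf hm (by rintro (_ | _) <;> simp; omega), Fintype.sum_option]
  have hc : ((2 * n - 1 : ℕ) : ℝ) = 2 * n - 1 := by rw [Nat.cast_sub (by omega)]; push_cast; rfl
  simp only [Option.elim_none, Option.elim_some, Finset.sum_const, Finset.card_univ, ZMod.card, hc]
  rw [show 2 * n - 1 - 1 = 2 * n - 2 by omega, Nat.sub_self, Multiset.replicate_zero, zero_add,
    Multiset.nsmul_replicate, add_assoc, ← Multiset.replicate_add, add_comm]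
  congr 2
  ring

/-- The two zeros come from the isolated vertices, where 2(m-1)(m-2) = 0 at m = 1 and (m-2)² has
multiplicity 0. -/
theorem cnslSpec_cccGraph_SD_of_even (hn : 2 ≤ n) (he : Even n) :
    cnslSpec (cccGraph (SD n)) = Multiset.replicate 2 (0 : ℝ) +
      Multiset.replicate 1 (2 * (2 * (n : ℝ) - 2) * (2 * (n : ℝ) - 3)) +
      Multiset.replicate (2 * n - 2) ((2 * (n : ℝ) - 3) ^ 2) := by
  obtain ⟨f, hf, hm⟩ := SD.exists_colouring_of_even hn he
  rw [cnslSpec_of_adj_iff hf hm (by rintro (_ | _) <;> simp; omega), Fintype.sum_option]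
  have hc : ((2 * n - 1 : ℕ) : ℝ) = 2 * n - 1 := by rw [Nat.cast_sub (by omega)]; push_cast; rfl
  simp only [Option.elim_none, Option.elim_some, Finset.sum_const, Finset.card_univ, ZMod.card, hc]
  rw [show 2 * n - 1 - 1 = 2 * n - 2 by omega, Nat.sub_self, Multiset.replicate_zero, zero_add,
    Multiset.nsmul_replicate, show 2 * (2 * (n : ℝ) - 1 - 1) * (2 * n - 1 - 2) =
      2 * (2 * n - 2) * (2 * n - 3) by ring,
    show (2 * (n : ℝ) - 1 - 2) ^ 2 = (2 * n - 3) ^ 2 by ring,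
    show 2 * (((1 : ℕ) : ℝ) - 1) * (((1 : ℕ) : ℝ) - 2) = 0 by norm_num]
  abel

theorem cnDelta_cccGraph_SD_of_even (hn : 2 ≤ n) (he : Even n) :
    cnDelta (cccGraph (SD n)) =
      (2 * (n : ℝ) - 1) * (2 * n - 2) * (2 * n - 3) / (2 * n + 1) := by
  obtain ⟨f, hf, hm⟩ := SD.exists_colouring_of_even hn he
  have hc : ((2 * n - 1 : ℕ) : ℝ) = 2 * n - 1 := by rw [Nat.cast_sub (by omega)]; push_cast; rfl
  rw [cnDelta_of_adj_iff hf hm, Fintype.sum_option, Fintype.sum_option]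
  simp only [Option.elim_none, Option.elim_some, Finset.sum_const, Finset.card_univ, ZMod.card, hc]
  push_cast
  congr 1 <;> simp only [nsmul_eq_mul] <;> push_cast <;> ring

theorem cnlSpec_cccGraph_SD_of_odd (hn : 2 ≤ n) (ho : Odd n) :
    cnlSpec (cccGraph (SD n)) = Multiset.replicate 2 (0 : ℝ) + Multiset.replicate 3 (8 : ℝ) +
      Multiset.replicate (2 * n - 3) ((2 * (n : ℝ) - 2) * (2 * (n : ℝ) - 4)) := by
  obtain ⟨f, hf, hm⟩ := SD.exists_colouring_of_odd hn ho
  rw [cnlSpec_of_adj_iff hf hm (by rintro (_ | _) <;> simp; omega), Fintype.sum_bool]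
  have hc : ((2 * n - 2 : ℕ) : ℝ) = 2 * n - 2 := by rw [Nat.cast_sub (by omega)]; push_cast; rfl
  simp only [cond_true, cond_false, hc]
  rw [show 2 * n - 2 - 1 = 2 * n - 3 by omega, show 2 * (n : ℝ) - 2 - 2 = 2 * n - 4 by ring,
    show ((4 : ℕ) : ℝ) * (((4 : ℕ) : ℝ) - 2) = 8 by norm_num, Multiset.replicate_add 1 1]
  abel

theorem cnslSpec_cccGraph_SD_of_odd (hn : 2 ≤ n) (ho : Odd n) :
    cnslSpec (cccGraph (SD n)) =
      Multiset.replicate 1 (2 * (2 * (n : ℝ) - 3) * (2 * (n : ℝ) - 4)) +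
      Multiset.replicate (2 * n - 3) ((2 * (n : ℝ) - 4) ^ 2) +
      Multiset.replicate 1 (12 : ℝ) + Multiset.replicate 3 (4 : ℝ) := by
  obtain ⟨f, hf, hm⟩ := SD.exists_colouring_of_odd hn ho
  rw [cnslSpec_of_adj_iff hf hm (by rintro (_ | _) <;> simp; omega), Fintype.sum_bool]
  have hc : ((2 * n - 2 : ℕ) : ℝ) = 2 * n - 2 := by rw [Nat.cast_sub (by omega)]; push_cast; rfl
  simp only [cond_true, cond_false, hc]
  rw [show 2 * n - 2 - 1 = 2 * n - 3 by omega, show 2 * (n : ℝ) - 2 - 2 = 2 * n - 4 by ring,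
    show 2 * (n : ℝ) - 2 - 1 = 2 * n - 3 by ring,
    show (((4 : ℕ) : ℝ) - 2) ^ 2 = 4 by norm_num,
    show 2 * (((4 : ℕ) : ℝ) - 1) * (((4 : ℕ) : ℝ) - 2) = 12 by norm_num]
  abel

theorem cnDelta_cccGraph_SD_of_odd (hn : 2 ≤ n) (ho : Odd n) :
    cnDelta (cccGraph (SD n)) =
      (2 * ((n : ℝ) - 1) * (n - 2) * (2 * n - 3) + 12) / (n + 1) := by
  obtain ⟨f, hf, hm⟩ := SD.exists_colouring_of_odd hn ho
  have hc : ((2 * n - 2 : ℕ) : ℝ) = 2 * n - 2 := by rw [Nat.cast_sub (by omega)]; push_cast; rfl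
  rw [cnDelta_of_adj_iff hf hm, Fintype.sum_bool, Fintype.sum_bool]
  simp only [cond_true, cond_false, hc]
  -- There are 2n + 2 vertices; the stated fraction has a common factor 2 cancelled.
  rw [eq_comm, ← mul_div_mul_left _ _ (two_ne_zero' ℝ)]
  congr 1 <;> push_cast <;> ring

theorem cnlEnergy_cccGraph_SD_of_even (hn : 2 ≤ n) (he : Even n) :
    cnlEnergy (cccGraph (SD n)) =
      12 * ((n : ℝ) - 1) * (4 * ((n : ℝ) - 2) * (n : ℝ) + 3) / (2 * (n : ℝ) + 1) := by
  have hx : (2 : ℝ) ≤ n := by exact_mod_cast hn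
  have hpos : (0 : ℝ) < 2 * n + 1 := by linarith
  have hc : ((2 * n - 2 : ℕ) : ℝ) = 2 * n - 2 := by rw [Nat.cast_sub (by omega)]; push_cast; rfl
  have e1 : (2 * (n : ℝ) - 1) * (2 * n - 3) -
      (2 * n - 1) * (2 * n - 2) * (2 * n - 3) / (2 * n + 1) =
      3 * (2 * n - 1) * (2 * n - 3) / (2 * n + 1) := by
    field_simp; ring
  have p1 : 0 ≤ 3 * (2 * (n : ℝ) - 1) * (2 * n - 3) / (2 * n + 1) :=
    div_nonneg (mul_nonneg (by linarith) (by linarith)) hpos.le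
  have p2 : 0 ≤ (2 * (n : ℝ) - 1) * (2 * n - 2) * (2 * n - 3) / (2 * n + 1) :=
    div_nonneg (mul_nonneg (mul_nonneg (by linarith) (by linarith)) (by linarith)) hpos.le
  rw [cnlEnergy, cnDelta_cccGraph_SD_of_even hn he, cnlSpec_cccGraph_SD_of_even hn he]
  simp only [Multiset.map_add, Multiset.map_replicate, Multiset.sum_add, Multiset.sum_replicate,
    nsmul_eq_mul, hc, e1, zero_sub, abs_neg, abs_of_nonneg p1, abs_of_nonneg p2]
  field_simp
  push_cast
  ring

/-- Exceptional because (2n-3)² = 1 lies below Δ = 6/5, whereas it exceeds Δ for even n ≥ 4. -/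
theorem cnslEnergy_cccGraph_SD_two : cnslEnergy (cccGraph (SD 2)) = 28 / 5 := by
  rw [cnslEnergy, cnDelta_cccGraph_SD_of_even le_rfl even_two,
    cnslSpec_cccGraph_SD_of_even le_rfl even_two]
  simp only [Multiset.map_add, Multiset.map_replicate, Multiset.sum_add, Multiset.sum_replicate,
    nsmul_eq_mul]
  norm_num [abs_of_pos, abs_of_neg]

theorem cnslEnergy_cccGraph_SD_of_even (hn : 4 ≤ n) (he : Even n) :
    cnslEnergy (cccGraph (SD n)) =
      8 * ((n : ℝ) - 1) * (2 * (n : ℝ) - 3) * (2 * (n : ℝ) - 1) / (2 * (n : ℝ) + 1) := by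
  have hx : (4 : ℝ) ≤ n := by exact_mod_cast hn
  have hpos : (0 : ℝ) < 2 * n + 1 := by linarith
  have hc : ((2 * n - 2 : ℕ) : ℝ) = 2 * n - 2 := by rw [Nat.cast_sub (by omega)]; push_cast; rfl
  have e1 : 2 * (2 * (n : ℝ) - 2) * (2 * n - 3) -
      (2 * n - 1) * (2 * n - 2) * (2 * n - 3) / (2 * n + 1) =
      (2 * n - 2) * (2 * n - 3) * (2 * n + 3) / (2 * n + 1) := by
    field_simp; ring
  have e2 : (2 * (n : ℝ) - 3) ^ 2 -
      (2 * n - 1) * (2 * n - 2) * (2 * n - 3) / (2 * n + 1) =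
      (2 * n - 3) * (2 * n - 5) / (2 * n + 1) := by
    field_simp; ring
  have p1 : 0 ≤ (2 * (n : ℝ) - 2) * (2 * n - 3) * (2 * n + 3) / (2 * n + 1) :=
    div_nonneg (mul_nonneg (mul_nonneg (by linarith) (by linarith)) (by linarith)) hpos.le
  have p2 : 0 ≤ (2 * (n : ℝ) - 3) * (2 * n - 5) / (2 * n + 1) :=
    div_nonneg (mul_nonneg (by linarith) (by linarith)) hpos.le
  have p3 : 0 ≤ (2 * (n : ℝ) - 1) * (2 * n - 2) * (2 * n - 3) / (2 * n + 1) :=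
    div_nonneg (mul_nonneg (mul_nonneg (by linarith) (by linarith)) (by linarith)) hpos.le
  rw [cnslEnergy, cnDelta_cccGraph_SD_of_even (by omega) he,
    cnslSpec_cccGraph_SD_of_even (by omega) he]
  simp only [Multiset.map_add, Multiset.map_replicate, Multiset.sum_add, Multiset.sum_replicate,
    nsmul_eq_mul, hc, e1, e2, zero_sub, abs_neg, abs_of_nonneg p1, abs_of_nonneg p2,
    abs_of_nonneg p3]
  field_simp
  push_cast
  ring

/-- Here the graph is 2K_4 and Δ = 6 lies below the eigenvalue 8, unlike for n ≥ 5. -/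
theorem cnlEnergy_cccGraph_SD_three : cnlEnergy (cccGraph (SD 3)) = 24 := by
  have ho : Odd 3 := by decide
  rw [cnlEnergy, cnDelta_cccGraph_SD_of_odd (by norm_num) ho,
    cnlSpec_cccGraph_SD_of_odd (by norm_num) ho]
  simp only [Multiset.map_add, Multiset.map_replicate, Multiset.sum_add, Multiset.sum_replicate,
    nsmul_eq_mul]
  norm_num

theorem cnslEnergy_cccGraph_SD_three : cnslEnergy (cccGraph (SD 3)) = 24 := by
  have ho : Odd 3 := by decide
  rw [cnslEnergy, cnDelta_cccGraph_SD_of_odd (by norm_num) ho,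
    cnslSpec_cccGraph_SD_of_odd (by norm_num) ho]
  simp only [Multiset.map_add, Multiset.map_replicate, Multiset.sum_add, Multiset.sum_replicate,
    nsmul_eq_mul]
  norm_num

/-- Places all eigenvalues coming from K_4, namely 0, 8 and 4, 12, on the lower side of Δ. -/
theorem twelve_le_cnDelta_cccGraph_SD_of_odd (hn : 5 ≤ n) (ho : Odd n) :
    12 ≤ cnDelta (cccGraph (SD n)) := by
  have hx : (5 : ℝ) ≤ n := by exact_mod_cast hn
  rw [cnDelta_cccGraph_SD_of_odd (by omega) ho, le_div_iff₀ (by linarith)]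
  have h : 3 * 7 ≤ ((n : ℝ) - 2) * (2 * n - 3) :=
    mul_le_mul (by linarith) (by linarith) (by norm_num) (by linarith)
  have h' := mul_le_mul_of_nonneg_left h (show 0 ≤ 2 * ((n : ℝ) - 1) by linarith)
  linarith

/-- (2n-4)² is the least nonzero eigenvalue of either matrix on K_{2n-2}, so all of these lie above
Δ. -/
theorem cnDelta_cccGraph_SD_le_of_odd (hn : 5 ≤ n) (ho : Odd n) :
    cnDelta (cccGraph (SD n)) ≤ (2 * (n : ℝ) - 4) ^ 2 := by
  have hx : (5 : ℝ) ≤ n := by exact_mod_cast hn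
  rw [cnDelta_cccGraph_SD_of_odd (by omega) ho, div_le_iff₀ (by linarith)]
  -- The cubic terms cancel, leaving 6n² - 26n + 16 ≥ 0.
  nlinarith [mul_nonneg (sub_nonneg.2 hx) (sub_nonneg.2 hx)]

theorem cnlEnergy_cccGraph_SD_of_odd (hn : 5 ≤ n) (ho : Odd n) :
    cnlEnergy (cccGraph (SD n)) =
      4 * (2 * (n : ℝ) - 3) * (5 * ((n : ℝ) - 3) * (n : ℝ) + 4) / ((n : ℝ) + 1) := by
  have hx : (5 : ℝ) ≤ n := by exact_mod_cast hn
  have hpos : (0 : ℝ) < n + 1 := by linarith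
  have hc : ((2 * n - 3 : ℕ) : ℝ) = 2 * n - 3 := by rw [Nat.cast_sub (by omega)]; push_cast; rfl
  have hl := twelve_le_cnDelta_cccGraph_SD_of_odd hn ho
  have hu := cnDelta_cccGraph_SD_le_of_odd hn ho
  have hu' : cnDelta (cccGraph (SD n)) ≤ (2 * (n : ℝ) - 2) * (2 * n - 4) := by nlinarith
  rw [cnlEnergy, cnlSpec_cccGraph_SD_of_odd (by omega) ho]
  simp only [Multiset.map_add, Multiset.map_replicate, Multiset.sum_add, Multiset.sum_replicate,
    nsmul_eq_mul, hc]
  rw [abs_of_nonpos (by linarith), abs_of_nonpos (by linarith), abs_of_nonneg (by linarith),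
    cnDelta_cccGraph_SD_of_odd (by omega) ho]
  field_simp
  push_cast
  ring

theorem cnslEnergy_cccGraph_SD_of_odd (hn : 5 ≤ n) (ho : Odd n) :
    cnslEnergy (cccGraph (SD n)) =
      16 * ((n : ℝ) - 3) * ((n : ℝ) - 1) * (2 * (n : ℝ) - 1) / ((n : ℝ) + 1) := by
  have hx : (5 : ℝ) ≤ n := by exact_mod_cast hn
  have hpos : (0 : ℝ) < n + 1 := by linarith
  have hc : ((2 * n - 3 : ℕ) : ℝ) = 2 * n - 3 := by rw [Nat.cast_sub (by omega)]; push_cast; rfl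
  have hl := twelve_le_cnDelta_cccGraph_SD_of_odd hn ho
  have hu := cnDelta_cccGraph_SD_le_of_odd hn ho
  have hu' : cnDelta (cccGraph (SD n)) ≤ 2 * (2 * (n : ℝ) - 3) * (2 * n - 4) := by nlinarith
  rw [cnslEnergy, cnslSpec_cccGraph_SD_of_odd (by omega) ho]
  simp only [Multiset.map_add, Multiset.map_replicate, Multiset.sum_add, Multiset.sum_replicate,
    nsmul_eq_mul, hc]
  rw [abs_of_nonneg (by linarith), abs_of_nonneg (by linarith), abs_of_nonpos (by linarith),
    abs_of_nonpos (by linarith), cnDelta_cccGraph_SD_of_odd (by omega) ho]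
  field_simp
  push_cast
  ring

end SemidihedralSpectra

theorem mainTheorem12 (n : ℕ) (hn : 2 ≤ n) :
    (Even n →
      (cnlSpec (cccGraph (SD n)) =
          Multiset.replicate 3 (0 : ℝ) +
          Multiset.replicate (2 * n - 2) ((2 * (n : ℝ) - 1) * (2 * (n : ℝ) - 3)) ∧
        cnlEnergy (cccGraph (SD n)) =
          12 * ((n : ℝ) - 1) * (4 * ((n : ℝ) - 2) * (n : ℝ) + 3) / (2 * (n : ℝ) + 1)) ∧
      (cnslSpec (cccGraph (SD n)) =
          Multiset.replicate 2 (0 : ℝ) +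
          Multiset.replicate 1 (2 * (2 * (n : ℝ) - 2) * (2 * (n : ℝ) - 3)) +
          Multiset.replicate (2 * n - 2) ((2 * (n : ℝ) - 3) ^ 2) ∧
        (n = 2 → cnslEnergy (cccGraph (SD n)) = 28 / 5) ∧
        (4 ≤ n → cnslEnergy (cccGraph (SD n)) =
          8 * ((n : ℝ) - 1) * (2 * (n : ℝ) - 3) * (2 * (n : ℝ) - 1) / (2 * (n : ℝ) + 1)))) ∧
    (Odd n →
      (cnlSpec (cccGraph (SD n)) =
          Multiset.replicate 2 (0 : ℝ) +
          Multiset.replicate 3 (8 : ℝ) +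
          Multiset.replicate (2 * n - 3) ((2 * (n : ℝ) - 2) * (2 * (n : ℝ) - 4)) ∧
        (n = 3 → cnlEnergy (cccGraph (SD n)) = 24) ∧
        (5 ≤ n → cnlEnergy (cccGraph (SD n)) =
          4 * (2 * (n : ℝ) - 3) * (5 * ((n : ℝ) - 3) * (n : ℝ) + 4) / ((n : ℝ) + 1))) ∧
      (cnslSpec (cccGraph (SD n)) =
          Multiset.replicate 1 (2 * (2 * (n : ℝ) - 3) * (2 * (n : ℝ) - 4)) +
          Multiset.replicate (2 * n - 3) ((2 * (n : ℝ) - 4) ^ 2) +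
          Multiset.replicate 1 (12 : ℝ) +
          Multiset.replicate 3 (4 : ℝ) ∧
        (n = 3 → cnslEnergy (cccGraph (SD n)) = 24) ∧
        (5 ≤ n → cnslEnergy (cccGraph (SD n)) =
          16 * ((n : ℝ) - 3) * ((n : ℝ) - 1) * (2 * (n : ℝ) - 1) / ((n : ℝ) + 1)))) := by
  refine ⟨fun he => ⟨⟨cnlSpec_cccGraph_SD_of_even hn he, cnlEnergy_cccGraph_SD_of_even hn he⟩,
    cnslSpec_cccGraph_SD_of_even hn he, ?_, fun h => cnslEnergy_cccGraph_SD_of_even h he⟩,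
    fun ho => ⟨⟨cnlSpec_cccGraph_SD_of_odd hn ho, ?_, fun h => cnlEnergy_cccGraph_SD_of_odd h ho⟩,
      cnslSpec_cccGraph_SD_of_odd hn ho, ?_, fun h => cnslEnergy_cccGraph_SD_of_odd h ho⟩⟩
  · rintro rfl; exact cnslEnergy_cccGraph_SD_two
  · rintro rfl; exact cnlEnergy_cccGraph_SD_three
  · rintro rfl; exact cnslEnergy_cccGraph_SD_three
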